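/- Let $n\ge 1$, $0<s_0<1$, $p>1$, and $s_1,\dots,s_n\in[s_0,1)$. Let $\bar s=\bigl(\frac1n\sum_{k=1}^n \frac1{s_k}\bigr)^{-1}$ be the harmonic mean of the orders, suppose $1<p<n/\bar s$, and put $p_\star=\frac{np}{n-p\bar s}$. For $x\in\mathbb{R}^n$ define the measure $$\mu_{\mathrm{axes}}(x,\mathrm{d}y)=\sum_{k=1}^n s_k(1-s_k)\,|x_k-y_k|^{-1-s_kp}\,\mathrm{d}y_k\prod_{i\ne k}\delta_{x_i}(\mathrm{d}y_i),$$ and let $V^{p,\mu_{\mathrm{axes}}}(\mathbb{R}^n|\mathbb{R}^n)$ be the set of all measurable $u:\mathbb{R}^n\to\mathbb{R}$ with $u\in L^p(\mathbb{R}^n)$ and $\int_{\mathbb{R}^n}\int_{\mathbb{R}^n}|u(y)-u(x)|^p\,\mu_{\mathrm{axes}}(x,\mathrm{d}y)\,\mathrm{d}x<\infty$. Then there is a constant $C>0$, depending only on $n$, $p$, $p_\star$ and $s_0$ (and not otherwise on $s_1,\dots,s_n$), such that for every $u\in V^{p,\mu_{\mathrm{axes}}}(\mathbb{R}^n|\mathbb{R}^n)$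 $$\|u\|_{L^{p_\star}(\mathbb{R}^n)}^p\le C\int_{\mathbb{R}^n}\int_{\mathbb{R}^n}|u(x)-u(y)|^p\,\mu_{\mathrm{axes}}(x,\mathrm{d}y)\,\mathrm{d}x.$$ -/

import Mathlib

open MeasureTheory
open scoped ENNReal

namespace AxesSobolev

/-- The harmonic mean `(n⁻¹ ∑ₖ 1 / sₖ)⁻¹` of the orders `s₁, …, sₙ`. -/
noncomputable def sBar {n : ℕ} (s : Fin n → ℝ) : ℝ :=
  ((1 / (n : ℝ)) * ∑ k, 1 / s k)⁻¹

/-- The Sobolev exponent `n p / (n - p s̄)`. -/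
noncomputable def sobolevExponent {n : ℕ} (p : ℝ) (s : Fin n → ℝ) : ℝ :=
  (n : ℝ) * p / ((n : ℝ) - p * sBar s)

/-- The measure `μ_axes(x, dy) = ∑ₖ sₖ (1 - sₖ) |xₖ - yₖ|^(-1 - sₖ p) dyₖ ∏_{i ≠ k} δ_{xᵢ}(dyᵢ)`
on `ℝⁿ`. The `k`-th summand lives on the line through `x` parallel to the `k`-th axis: it is the
image of the measure `|xₖ - t|^(-1 - sₖ p) dt` on `ℝ` under the map sending `t` to the point `x`
with its `k`-th coordinate replaced by `t`. -/
noncomputable def muAxes {n : ℕ} (p : ℝ) (s : Fin n → ℝ) (x : Fin n → ℝ) :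
    Measure (Fin n → ℝ) :=
  ∑ k, ENNReal.ofReal (s k * (1 - s k)) •
    ((volume : Measure ℝ).withDensity
      (fun t => ENNReal.ofReal (|x k - t| ^ (-1 - s k * p)))).map (Function.update x k)

/-- The quantity `(u, u)_{V^{p,μ}(Ω|ℝⁿ)} = ∫_Ω ∫_{ℝⁿ} |u(y) - u(x)|^p μ(x, dy) dx ∈ [0, ∞]`
(for `v = u` the integrand `|u(y) - u(x)|^(p-2) (u(y) - u(x)) (v(y) - v(x))` of the form
`(u, v)` is `|u(y) - u(x)|^p`). -/
noncomputable def vEnergy {n : ℕ} (p : ℝ) (μ : (Fin n → ℝ) → Measure (Fin n → ℝ))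
    (Ω : Set (Fin n → ℝ)) (u : (Fin n → ℝ) → ℝ) : ℝ≥0∞ :=
  ∫⁻ x in Ω, ∫⁻ y, ENNReal.ofReal (|u y - u x| ^ p) ∂(μ x)

/-- The function space `V^{p,μ}(Ω|ℝⁿ)`: (Lebesgue) measurable functions `u : ℝⁿ → ℝ` with
`u|_Ω ∈ L^p(Ω)` and `(u, u)_{V^{p,μ}(Ω|ℝⁿ)} < ∞`. -/
def vSpace {n : ℕ} (p : ℝ) (μ : (Fin n → ℝ) → Measure (Fin n → ℝ))
    (Ω : Set (Fin n → ℝ)) : Set ((Fin n → ℝ) → ℝ) :=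
  {u | AEMeasurable u volume ∧ MemLp u (ENNReal.ofReal p) (volume.restrict Ω) ∧
    vEnergy p μ Ω u < ∞}

end AxesSobolev

/-! Truncation at dyadic heights reduces the inequality to a bound for level sets. With θ = p s̄ / n
and E = `axesForm`, it reads |{v ≥ 1}| ≤ C |supp v|^θ E(v) (`volume_superlevel_le`). Take a box of
shifts z whose volume is twice that of supp v and whose sides are adapted to the orders. If v(x) ≥
1, then v(x + z) = 0 for at least half of these shifts, so increments averaged over the box control
|{v ≥ 1}|. Increments split along the axes, and on each axis the doubling argument of
`setLIntegral_Ioc_le` produces the factor 1 - s_k, which keeps C uniform as s_k → 1.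

Apply this to the slices of |u| between 2^j and 2^(j+1). For b_j = 2^(jq) |{|u| > 2^j}| with q = p /
(1 - θ) = p_⋆, it gives b_{j+1} ≤ D b_j^θ e_j, where e_j is the energy of the j-th slice and ∑ e_j ≤
E(u) (`tsum_axesForm_slice_le`). Since θ < 1, `tsum_le_of_recursion` yields ∑ b_j ≤ (D
E(u))^(1/(1-θ)), and ∑ b_j bounds the q-th power of the L^q norm up to the factor 2^q. -/

namespace AxesSobolev

/-- The `p`-th power of the `L^p` norm of the increment `u (· + z) - u`. -/
noncomputable def incr {n : ℕ} (p : ℝ) (u : (Fin n → ℝ) → ℝ) (z : Fin n → ℝ) : ℝ≥0∞ :=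
  ∫⁻ x, ‖u (x + z) - u x‖ₑ ^ p

/-- The anisotropic fractional energy, written with increments along the axes. -/
noncomputable def axesForm {n : ℕ} (p : ℝ) (s : Fin n → ℝ) (u : (Fin n → ℝ) → ℝ) : ℝ≥0∞ :=
  ∑ k, ENNReal.ofReal (s k * (1 - s k)) *
    ∫⁻ h : ℝ, ENNReal.ofReal (|h| ^ (-1 - s k * p)) * incr p u (Pi.single k h)

/-! ### Subadditivity of increments and splitting along the axes. -/

section Increments

variable {n : ℕ} {p : ℝ} {u : (Fin n → ℝ) → ℝ}

lemma measurable_increment (hu : Measurable u) (p : ℝ) :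
    Measurable fun q : (Fin n → ℝ) × (Fin n → ℝ) => ‖u (q.2 + q.1) - u q.2‖ₑ ^ p := by
  fun_prop

lemma measurable_incr (hu : Measurable u) (p : ℝ) : Measurable (incr p u) :=
  (measurable_increment hu p).lintegral_prod_right'

lemma measurable_incr_single (hu : Measurable u) (p : ℝ) (k : Fin n) :
    Measurable fun h : ℝ => incr p u (Pi.single k h) :=
  (measurable_incr hu p).comp (continuous_single k).measurable

/-- Minkowski's inequality, once translation invariance has moved the base point of the second
increment to x + z. -/
lemma incr_rpow_add_le (hp : 1 ≤ p) (hu : Measurable u) (z w : Fin n → ℝ) :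
    incr p u (z + w) ^ (1 / p) ≤ incr p u z ^ (1 / p) + incr p u w ^ (1 / p) := by
  have hp0 : 0 < p := by linarith
  have h1 : incr p u w = ∫⁻ x, ‖u (x + z + w) - u (x + z)‖ₑ ^ p := by
    have := lintegral_add_right_eq_self (μ := (volume : Measure (Fin n → ℝ)))
      (fun x => ‖u (x + w) - u x‖ₑ ^ p) z
    rw [incr, ← this]
  rw [add_comm (incr p u z ^ (1 / p)), h1]
  refine le_trans ?_ (ENNReal.lintegral_Lp_add_le (p := p) (μ := volume)
    (f := fun x => ‖u (x + z + w) - u (x + z)‖ₑ) (g := fun x => ‖u (x + z) - u x‖ₑ)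
    (by fun_prop) (by fun_prop) hp)
  unfold incr
  gcongr with x
  simp only [Pi.add_apply]
  refine le_trans (le_of_eq ?_) (enorm_add_le _ _)
  rw [← add_assoc]
  congr 1
  ring

lemma incr_zero (hp : 0 < p) : incr p u 0 = 0 := by
  simp [incr, hp]

lemma incr_two_mul_le (hp : 1 ≤ p) (hu : Measurable u) (z : Fin n → ℝ) :
    incr p u (z + z) ≤ 2 ^ p * incr p u z := by
  have hp0 : 0 < p := by linarith
  have h := incr_rpow_add_le hp hu z z
  rw [← two_mul (_ ^ (1 / p))] at h
  have h2 := ENNReal.rpow_le_rpow h hp0.le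
  rwa [ENNReal.mul_rpow_of_nonneg _ _ hp0.le, ← ENNReal.rpow_mul, ← ENNReal.rpow_mul,
    one_div_mul_cancel hp0.ne', ENNReal.rpow_one, ENNReal.rpow_one] at h2

/-- Join x to x + z by segments parallel to the axes; the power n^(p-1) comes from the convexity of
t ↦ t^p. -/
lemma incr_le_sum_single (hp : 1 ≤ p) (hu : Measurable u) (z : Fin n → ℝ) :
    incr p u z ≤ (n : ℝ≥0∞) ^ (p - 1) * ∑ k, incr p u (Pi.single k (z k)) := by
  have hp0 : 0 < p := by linarith
  have h := Finset.le_sum_of_subadditive (fun z => incr p u z ^ (1 / p))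
    (by simp [incr_zero hp0, hp0]) (incr_rpow_add_le hp hu) Finset.univ
    (fun k => Pi.single k (z k))
  simp only [Finset.univ_sum_single] at h
  have h2 := (ENNReal.rpow_le_rpow h hp0.le).trans
    (ENNReal.rpow_sum_le_const_mul_sum_rpow _ _ hp)
  simpa [← ENNReal.rpow_mul, hp0.ne'] using h2

end Increments

/-! ### One axis: dyadic averages against the weighted integral. -/

lemma one_sub_two_rpow_neg_le (x : ℝ) (hx : 0 ≤ x) : 1 - (2 : ℝ) ^ (-x) ≤ x := by
  have h := Real.add_one_le_exp (Real.log 2 * (-x))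
  rw [Real.rpow_def_of_pos two_pos]
  have := Real.log_two_lt_d9
  nlinarith

lemma lintegral_comp_two_mul {F : ℝ → ℝ≥0∞} (hF : Measurable F) :
    ∫⁻ h, F h = 2 * ∫⁻ h, F (2 * h) := by
  have h := lintegral_map (μ := volume) hF (measurable_const_mul (2 : ℝ))
  rw [Real.map_volume_mul_left two_ne_zero, lintegral_smul_measure] at h
  rw [← h, smul_eq_mul, ← mul_assoc, abs_of_pos (by positivity),
    ENNReal.ofReal_inv_of_pos two_pos, ENNReal.ofReal_ofNat,
    ENNReal.mul_inv_cancel (by simp) (by simp), one_mul]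

/-- A function on the half line which is doubling with constant `2 ^ p` is controlled on a dyadic
interval by its integral against `h ^ (-1 - s p)`, with a gain of the factor `1 - s`. -/
lemma setLIntegral_Ioc_le {p s r : ℝ} (hp : 0 < p) (hs : s < 1) (hs0 : 0 < s) (hr : 0 < r)
    {W : ℝ → ℝ≥0∞} (hWm : Measurable W) (hW : ∀ h, W (h + h) ≤ 2 ^ p * W h) :
    ∫⁻ h in Set.Ioc r (2 * r), W h ≤
      ENNReal.ofReal ((2 * r) ^ (1 + s * p) * (p * (1 - s))) *
        ∫⁻ h, ENNReal.ofReal (|h| ^ (-1 - s * p)) * W h := by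
  set w : ℝ → ℝ≥0∞ := fun h => ENNReal.ofReal (|h| ^ (-1 - s * p)) with hw
  have hwm : Measurable w := by fun_prop
  set J := ∫⁻ h in Set.Ioc 0 (2 * r), w h * W h with hJ
  set J₁ := ∫⁻ h in Set.Ioc 0 r, w h * W h with hJ₁
  set J₂ := ∫⁻ h in Set.Ioc r (2 * r), w h * W h with hJ₂
  have hJle : J ≤ ∫⁻ h, w h * W h := setLIntegral_le_lintegral _ _
  have hsum : J = J₁ + J₂ := by
    rw [hJ, ← Set.Ioc_union_Ioc_eq_Ioc hr.le (by linarith : r ≤ 2 * r),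
      lintegral_union measurableSet_Ioc (Set.Ioc_disjoint_Ioc_of_le le_rfl)]
  -- Substituting h → 2h costs 2 from the measure, 2^(-1 - sp) from the weight and at most 2^p from
  -- W: together 2^((1-s)p).
  have hscale : J ≤ ENNReal.ofReal (2 ^ ((1 - s) * p)) * J₁ := by
    rw [hJ, ← lintegral_indicator measurableSet_Ioc,
      lintegral_comp_two_mul ((hwm.fun_mul hWm).indicator measurableSet_Ioc), hJ₁,
      ← lintegral_indicator measurableSet_Ioc, ← lintegral_const_mul' _ _ (by simp),
      ← lintegral_const_mul' _ _ (by simp)]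
    refine lintegral_mono fun h => ?_
    by_cases hh : h ∈ Set.Ioc 0 r
    · have h2 : 2 * h ∈ Set.Ioc 0 (2 * r) := ⟨by linarith [hh.1], by linarith [hh.2]⟩
      simp only [Set.indicator_of_mem hh, Set.indicator_of_mem h2]
      have hw2 : w (2 * h) = ENNReal.ofReal (2 ^ (-1 - s * p)) * w h := by
        simp only [hw]
        rw [← ENNReal.ofReal_mul (by positivity), abs_mul, abs_two,
          Real.mul_rpow (by norm_num) (abs_nonneg _)]
      have h2p : (2 : ℝ≥0∞) ^ p = ENNReal.ofReal (2 ^ p) := by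
        rw [← ENNReal.ofReal_rpow_of_pos two_pos]; simp
      have h22 : (2 : ℝ≥0∞) = ENNReal.ofReal 2 := by simp
      calc 2 * (w (2 * h) * W (2 * h)) ≤ 2 * (w (2 * h) * (2 ^ p * W h)) := by
            gcongr
            rw [two_mul]
            exact hW h
        _ = ENNReal.ofReal 2 * ENNReal.ofReal (2 ^ (-1 - s * p)) * ENNReal.ofReal (2 ^ p) *
              (w h * W h) := by
            rw [hw2, h2p, ← h22]; ring
        _ = _ := by
            rw [← ENNReal.ofReal_mul (by positivity), ← ENNReal.ofReal_mul (by positivity)]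
            congr 2
            rw [show (2 : ℝ) * 2 ^ (-1 - s * p) = 2 ^ (1 : ℝ) * 2 ^ (-1 - s * p) by simp,
              ← Real.rpow_add two_pos, ← Real.rpow_add two_pos]
            congr 1; ring
    · have h2 : 2 * h ∉ Set.Ioc 0 (2 * r) := fun h2 =>
        hh ⟨by linarith [h2.1], by linarith [h2.2]⟩
      simp [Set.indicator_of_notMem h2]
  have hps : 0 < p * (1 - s) := mul_pos hp (by linarith)
  have hm : ∫⁻ h in Set.Ioc r (2 * r), W h ≤ ENNReal.ofReal ((2 * r) ^ (1 + s * p)) * J₂ := by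
    rw [hJ₂, ← lintegral_const_mul' _ _ (by simp)]
    refine setLIntegral_mono' measurableSet_Ioc fun h hh => ?_
    have hh0 : 0 < h := hr.trans hh.1
    rw [← mul_assoc, hw, ← ENNReal.ofReal_mul (by positivity)]
    refine le_mul_of_one_le_left (zero_le) ?_
    rw [ENNReal.one_le_ofReal, abs_of_pos hh0, show -1 - s * p = -(1 + s * p) by ring,
      Real.rpow_neg hh0.le, ← div_eq_mul_inv, one_le_div (by positivity)]
    exact Real.rpow_le_rpow hh0.le hh.2 (by positivity)
  -- J₂ = J - J₁ ≤ (1 - 2^(-(1-s)p)) J, which is where 1 - s appears. The subtraction is carried out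
  -- in the reals, so J = ∞ is treated separately.
  have hJ₂le : J₂ ≤ ENNReal.ofReal (p * (1 - s)) * J := by
    rcases eq_or_ne J ∞ with hJt | hJt
    · rw [hJt, ENNReal.mul_top (by simpa using hps)]; exact le_top
    have hJ₁t : J₁ ≠ ∞ := fun h => hJt (by rw [hsum, h, top_add])
    have hJ₂t : J₂ ≠ ∞ := fun h => hJt (by rw [hsum, h, add_top])
    have e1 : J.toReal = J₁.toReal + J₂.toReal := by rw [hsum, ENNReal.toReal_add hJ₁t hJ₂t]
    have e2 : J.toReal ≤ 2 ^ ((1 - s) * p) * J₁.toReal := by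
      have := ENNReal.toReal_mono (ENNReal.mul_ne_top (by simp) hJ₁t) hscale
      rwa [ENNReal.toReal_mul, ENNReal.toReal_ofReal (by positivity)] at this
    have e3 : (2 : ℝ) ^ (-((1 - s) * p)) * J.toReal ≤ J₁.toReal := by
      rw [Real.rpow_neg two_pos.le, inv_mul_le_iff₀ (by positivity)]; exact e2
    have e4 := one_sub_two_rpow_neg_le ((1 - s) * p) (by nlinarith)
    rw [← ENNReal.ofReal_toReal hJ₂t, ← ENNReal.ofReal_toReal hJt,
      ← ENNReal.ofReal_mul hps.le]
    apply ENNReal.ofReal_le_ofReal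
    nlinarith [ENNReal.toReal_nonneg (a := J)]
  calc _ ≤ _ := hm
    _ ≤ ENNReal.ofReal ((2 * r) ^ (1 + s * p)) *
        (ENNReal.ofReal (p * (1 - s)) * ∫⁻ h, w h * W h) := by gcongr; exact hJ₂le.trans (by gcongr)
    _ = _ := by rw [← mul_assoc, ← ENNReal.ofReal_mul (by positivity)]

/-! ### The level set estimate by averaging over a box. -/

lemma setLIntegral_pi_eval {n : ℕ} (r : Fin n → ℝ) (hr : ∀ k, 0 < r k) (k : Fin n)
    {W : ℝ → ℝ≥0∞} (hW : Measurable W) :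
    ∫⁻ z in Set.univ.pi (fun k => Set.Ioc (r k) (2 * r k)), W (z k) =
      (∏ k, ENNReal.ofReal (r k)) *
        ((ENNReal.ofReal (r k))⁻¹ * ∫⁻ h in Set.Ioc (r k) (2 * r k), W h) := by
  have h1 := lintegral_map (μ := (volume : Measure (Fin n → ℝ)).restrict
    (Set.univ.pi (fun k => Set.Ioc (r k) (2 * r k)))) hW (measurable_pi_apply k)
  rw [← h1, volume_pi, Measure.restrict_pi_pi]
  have h2 := Measure.pi_map_eval (fun k => (volume : Measure ℝ).restrict
    (Set.Ioc (r k) (2 * r k))) k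
  have h3 : ENNReal.ofReal (r k) ≠ 0 := by simpa using hr k
  simp only [Measure.restrict_apply_univ, Real.volume_Ioc] at h2
  rw [h2, lintegral_smul_measure, smul_eq_mul, ← mul_assoc,
    ← Finset.prod_erase_mul _ _ (Finset.mem_univ k), mul_assoc _ _ (ENNReal.ofReal (r k))⁻¹,
    ENNReal.mul_inv_cancel h3 (by simp), mul_one]
  congr 1
  refine Finset.prod_congr rfl fun j _ => ?_
  congr 1; ring

lemma volume_superlevel_le_sum {n : ℕ} {p : ℝ} (hp : 1 ≤ p) {v : (Fin n → ℝ) → ℝ}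
    (hv : Measurable v) (r : Fin n → ℝ) (hr : ∀ k, 0 < r k)
    (hvol : ∏ k, ENNReal.ofReal (r k) = 2 * volume (Function.support v)) :
    volume {x | 1 ≤ v x} ≤ 2 * (n : ℝ≥0∞) ^ (p - 1) * ∑ k, (ENNReal.ofReal (r k))⁻¹ *
      ∫⁻ h in Set.Ioc (r k) (2 * r k), incr p v (Pi.single k h) := by
  have hp0 : 0 < p := by linarith
  set a := volume (Function.support v) with ha
  set H := Set.univ.pi (fun k => Set.Ioc (r k) (2 * r k)) with hH
  have ha0 : a ≠ 0 := by
    intro h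
    rw [h, mul_zero, Finset.prod_eq_zero_iff] at hvol
    obtain ⟨k, -, hk⟩ := hvol
    exact absurd hk (by simpa using hr k)
  have hat : a ≠ ∞ := by
    intro h
    rw [h, ENNReal.mul_top two_ne_zero] at hvol
    exact (ENNReal.prod_ne_top (fun k _ => by simp)) hvol
  have hHm : MeasurableSet H := MeasurableSet.univ_pi fun k => measurableSet_Ioc
  have hHv : volume H = 2 * a := by
    rw [hH, Real.volume_pi_Ioc, ← hvol]
    refine Finset.prod_congr rfl fun k _ => ?_
    congr 1; ring
  have hsm : MeasurableSet {x | 1 ≤ v x} := measurableSet_le measurable_const hv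
  have hpt : ∀ x, 1 ≤ v x → a ≤ ∫⁻ z in H, ‖v (x + z) - v x‖ₑ ^ p := by
    intro x hx
    set Z := {z | v (x + z) = 0} with hZ
    have hZm : MeasurableSet Z := by
      have : Measurable fun z => v (x + z) := by fun_prop
      exact this (measurableSet_singleton 0)
    -- The shifts taking x into the support have measure a, half of the volume of the box.
    have h1 : volume H ≤ volume (Z ∩ H) + a := by
      have hsub : H ⊆ (Z ∩ H) ∪ (fun z => x + z) ⁻¹' Function.support v := by
        intro z hz
        by_cases h : v (x + z) = 0
        · exact Or.inl ⟨h, hz⟩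
        · exact Or.inr h
      refine (measure_mono hsub).trans ((measure_union_le _ _).trans ?_)
      rw [measure_preimage_add]
    have h2 : a ≤ volume (Z ∩ H) := by
      rw [hHv, two_mul] at h1
      exact (ENNReal.add_le_add_iff_right hat).1 h1
    calc a ≤ volume (Z ∩ H) := h2
      _ = ∫⁻ z in Z ∩ H, 1 := by simp
      _ ≤ ∫⁻ z in Z ∩ H, ‖v (x + z) - v x‖ₑ ^ p := by
          refine setLIntegral_mono' (hZm.inter hHm) fun z hz => ?_
          have hz0 : v (x + z) = 0 := hz.1
          rw [hz0, zero_sub, enorm_neg, Real.enorm_eq_ofReal_abs]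
          refine ENNReal.one_le_rpow ?_ hp0
          rw [ENNReal.one_le_ofReal]
          exact hx.trans (le_abs_self _)
      _ ≤ _ := lintegral_mono_set Set.inter_subset_right
  have hmain : a * volume {x | 1 ≤ v x} ≤ ∫⁻ z in H, incr p v z := by
    calc a * volume {x | 1 ≤ v x} = ∫⁻ x in {x | 1 ≤ v x}, a := by simp
      _ ≤ ∫⁻ x in {x | 1 ≤ v x}, ∫⁻ z in H, ‖v (x + z) - v x‖ₑ ^ p :=
          setLIntegral_mono' hsm fun x hx => hpt x hx
      _ ≤ ∫⁻ x, ∫⁻ z in H, ‖v (x + z) - v x‖ₑ ^ p := setLIntegral_le_lintegral _ _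
      _ = _ := by
          rw [lintegral_lintegral_swap]
          · rfl
          · exact ((measurable_increment hv p).comp measurable_swap).aemeasurable
  have hsum : ∫⁻ z in H, incr p v z ≤ (n : ℝ≥0∞) ^ (p - 1) * ∑ k, (2 * a) *
      ((ENNReal.ofReal (r k))⁻¹ *
        ∫⁻ h in Set.Ioc (r k) (2 * r k), incr p v (Pi.single k h)) := by
    calc _ ≤ ∫⁻ z in H, (n : ℝ≥0∞) ^ (p - 1) * ∑ k, incr p v (Pi.single k (z k)) :=
          lintegral_mono fun z => incr_le_sum_single hp hv z
      _ = _ := by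
          have hm : ∀ k : Fin n, Measurable fun z : Fin n → ℝ => incr p v (Pi.single k (z k)) :=
            fun k => (measurable_incr_single hv p k).comp (measurable_pi_apply k)
          rw [lintegral_const_mul _ (Finset.measurable_fun_sum _ fun k _ => hm k),
            lintegral_finsetSum _ fun k _ => hm k]
          congr 1
          refine Finset.sum_congr rfl fun k _ => ?_
          rw [setLIntegral_pi_eval r hr k (measurable_incr_single hv p k), hvol]
  have h := hmain.trans hsum
  rw [← Finset.mul_sum, ← mul_assoc, mul_comm _ (2 * a), mul_comm 2 a, mul_assoc, mul_assoc,
    ENNReal.mul_le_mul_iff_right ha0 hat] at h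
  rwa [mul_assoc]

/-- The constant of the measure estimate for superlevel sets. -/
noncomputable def levelConst (n : ℕ) (p s₀ : ℝ) : ℝ :=
  8 * ((n : ℝ) + 1) ^ (p - 1) * 2 ^ p * (p / s₀)

/-- The base n + 1 in place of n keeps the constant positive even for n = 0. -/
lemma levelConst_pos {n : ℕ} {p s₀ : ℝ} (hp : 1 < p) (hs₀ : 0 < s₀) : 0 < levelConst n p s₀ := by
  unfold levelConst; positivity

lemma sum_one_div_eq {n : ℕ} (hn : n ≠ 0) (s : Fin n → ℝ) (hs : ∀ k, 0 < s k) :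
    sBar s * ∑ k, 1 / s k = n := by
  have hn' : (0 : ℝ) < n := by positivity
  have : Nonempty (Fin n) := ⟨⟨0, Nat.pos_of_ne_zero hn⟩⟩
  have h : 0 < ∑ k, 1 / s k :=
    Finset.sum_pos (fun k _ => by have := hs k; positivity) Finset.univ_nonempty
  rw [sBar]
  field_simp

lemma sBar_pos {n : ℕ} (hn : n ≠ 0) (s : Fin n → ℝ) (hs : ∀ k, 0 < s k) : 0 < sBar s := by
  have hn' : (0 : ℝ) < n := by positivity
  have : Nonempty (Fin n) := ⟨⟨0, Nat.pos_of_ne_zero hn⟩⟩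
  have h : 0 < ∑ k, 1 / s k :=
    Finset.sum_pos (fun k _ => by have := hs k; positivity) Finset.univ_nonempty
  rw [sBar]
  positivity

/-- The measure of `{1 ≤ v}` is controlled by the measure of the support of `v` and the energy. -/
lemma volume_superlevel_le {n : ℕ} (hn : n ≠ 0) {p s₀ : ℝ} (hp : 1 < p) (hs₀ : 0 < s₀)
    {s : Fin n → ℝ} (hs : ∀ k, s₀ ≤ s k ∧ s k < 1) (hθ : p * sBar s / n ≤ 1)
    {v : (Fin n → ℝ) → ℝ} (hv : Measurable v) (hfin : volume (Function.support v) ≠ ∞) :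
    volume {x | 1 ≤ v x} ≤ ENNReal.ofReal (levelConst n p s₀) *
      volume (Function.support v) ^ (p * sBar s / n) * axesForm p s v := by
  have hp0 : 0 < p := by linarith
  have hspos : ∀ k, 0 < s k := fun k => hs₀.trans_le (hs k).1
  have hn' : (0 : ℝ) < n := by positivity
  rcases eq_or_ne (volume (Function.support v)) 0 with h0 | h0
  · have : volume {x | 1 ≤ v x} = 0 := by
      refine measure_mono_null (fun x hx => ?_) h0
      have : (1 : ℝ) ≤ v x := hx
      exact Function.mem_support.2 (by linarith)
    rw [this]; exact zero_le
  set θ := p * sBar s / n with hθd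
  set a := (volume (Function.support v)).toReal with ha
  have ha0 : 0 < a := ENNReal.toReal_pos h0 hfin
  have haE : volume (Function.support v) = ENNReal.ofReal a := (ENNReal.ofReal_toReal hfin).symm
  -- The exponents make r_k^(s_k p) = (2a)^θ the same on every axis, and they sum to 1, so the box
  -- has volume 2a.
  set r : Fin n → ℝ := fun k => (2 * a) ^ (sBar s / n * (1 / s k)) with hrd
  have hr : ∀ k, 0 < r k := fun k => by simp only [hrd]; positivity
  have hprod : ∏ k, r k = 2 * a := by
    simp only [hrd]
    rw [← Real.rpow_sum_of_pos (by positivity), ← Finset.mul_sum, div_mul_eq_mul_div,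
      sum_one_div_eq hn s hspos, div_self hn'.ne', Real.rpow_one]
  have hvol : ∏ k, ENNReal.ofReal (r k) = 2 * volume (Function.support v) := by
    rw [← ENNReal.ofReal_prod_of_nonneg fun k _ => (hr k).le, hprod, haE,
      ENNReal.ofReal_mul two_pos.le, ENNReal.ofReal_ofNat]
  refine (volume_superlevel_le_sum hp.le hv r hr hvol).trans ?_
  have hθ0 : 0 < θ := by have := sBar_pos hn s hspos; positivity
  have hk : ∀ k, (ENNReal.ofReal (r k))⁻¹ *
      ∫⁻ h in Set.Ioc (r k) (2 * r k), incr p v (Pi.single k h) ≤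
      ENNReal.ofReal (4 * 2 ^ p * (p / s₀) * a ^ θ) * (ENNReal.ofReal (s k * (1 - s k)) *
        ∫⁻ h : ℝ, ENNReal.ofReal (|h| ^ (-1 - s k * p)) * incr p v (Pi.single k h)) := by
    intro k
    have hsk := hspos k
    have h1s : 0 < 1 - s k := by linarith [(hs k).2]
    have h1 := setLIntegral_Ioc_le hp0 (hs k).2 hsk (hr k) (measurable_incr_single hv p k)
      (fun h => by
        rw [Pi.single_add]
        exact incr_two_mul_le hp.le hv _)
    rw [← ENNReal.ofReal_inv_of_pos (hr k)]
    refine (mul_le_mul_right h1 _).trans ?_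
    rw [← mul_assoc, ← ENNReal.ofReal_mul (by have := hr k; positivity),
      ← mul_assoc (ENNReal.ofReal (4 * _ * _ * _)), ← ENNReal.ofReal_mul (by positivity)]
    refine mul_le_mul_left (ENNReal.ofReal_le_ofReal ?_) _
    have hrs : r k ^ (s k * p) = (2 * a) ^ θ := by
      simp only [hrd]
      rw [← Real.rpow_mul (by positivity)]
      congr 1
      rw [hθd]
      field_simp
    have hr1 : (r k)⁻¹ * (2 * r k) ^ (1 + s k * p) = 2 * 2 ^ (s k * p) * (2 * a) ^ θ := by
      rw [Real.rpow_add (by have := hr k; positivity), Real.rpow_one,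
        Real.mul_rpow two_pos.le (hr k).le, hrs]
      have := (hr k).ne'
      field_simp
    rw [← mul_assoc, hr1, Real.mul_rpow two_pos.le ha0.le]
    have e1 : (2 : ℝ) ^ (s k * p) ≤ 2 ^ p :=
      Real.rpow_le_rpow_of_exponent_le one_le_two (by nlinarith [(hs k).2])
    have e2 : (2 : ℝ) ^ θ ≤ 2 := by
      simpa using Real.rpow_le_rpow_of_exponent_le one_le_two hθ
    -- Supplies the factor s_k present in the energy; the price is the 1 / s₀ in the constant.
    have e3 : p ≤ p / s₀ * s k := by
      rw [div_mul_eq_mul_div, le_div_iff₀ hs₀]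
      exact mul_le_mul_of_nonneg_left (hs k).1 hp0.le
    calc 2 * 2 ^ (s k * p) * (2 ^ θ * a ^ θ) * (p * (1 - s k))
        ≤ 2 * 2 ^ p * (2 * a ^ θ) * ((p / s₀ * s k) * (1 - s k)) := by gcongr
      _ = _ := by ring
  have hn1 : (n : ℝ≥0∞) ^ (p - 1) ≤ ENNReal.ofReal (((n : ℝ) + 1) ^ (p - 1)) := by
    rw [← ENNReal.ofReal_rpow_of_pos (by positivity)]
    refine ENNReal.rpow_le_rpow ?_ (by linarith)
    rw [← ENNReal.ofReal_natCast]
    exact ENNReal.ofReal_le_ofReal (by linarith)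
  calc _ ≤ 2 * ENNReal.ofReal (((n : ℝ) + 1) ^ (p - 1)) *
        ∑ k, ENNReal.ofReal (4 * 2 ^ p * (p / s₀) * a ^ θ) *
          (ENNReal.ofReal (s k * (1 - s k)) *
        ∫⁻ h : ℝ, ENNReal.ofReal (|h| ^ (-1 - s k * p)) * incr p v (Pi.single k h)) := by
        exact mul_le_mul' (by gcongr) (Finset.sum_le_sum fun k _ => hk k)
    _ = _ := by
        rw [← Finset.mul_sum, ← axesForm, haE, ENNReal.ofReal_rpow_of_pos ha0,
          show (2 : ℝ≥0∞) = ENNReal.ofReal 2 by simp, ← ENNReal.ofReal_mul (by positivity),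
          ← mul_assoc, ← ENNReal.ofReal_mul (by positivity),
          ← ENNReal.ofReal_mul (levelConst_pos hp hs₀).le]
        congr 2
        rw [levelConst]
        ring

/-! ### Dyadic slices and their energies. -/

/-- The part of `t` between the heights `c` and `2 c`. -/
noncomputable def slice (c t : ℝ) : ℝ := max (min t (2 * c)) c - c

lemma measurable_slice (c : ℝ) : Measurable (slice c) := by
  unfold slice; fun_prop

lemma slice_ne_zero_iff {c t : ℝ} (hc : 0 < c) : slice c t ≠ 0 ↔ c < t := by
  unfold slice
  rw [sub_ne_zero]
  constructor
  · intro h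
    by_contra! h'
    exact h (max_eq_right ((min_le_left _ _).trans h'))
  · intro h
    have : c < min t (2 * c) := lt_min h (by linarith)
    rw [max_eq_left this.le]
    exact this.ne'

lemma le_slice {c t : ℝ} (hc : 0 < c) (h : 2 * c ≤ t) : c ≤ slice c t := by
  unfold slice
  rw [min_eq_right h, max_eq_left (by linarith)]
  linarith

/-- Reading increments of a slice as lengths of overlaps turns the sum over all slices into
additivity of measure on disjoint bands. -/
lemma ofReal_slice_sub {c a b : ℝ} (hc : 0 < c) (hab : b ≤ a) :
    ENNReal.ofReal |slice c a - slice c b| =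
      volume (Set.Ioc c (2 * c) ∩ Set.Ioc b a) := by
  rw [Set.Ioc_inter_Ioc, Real.volume_Ioc]
  unfold slice
  have hm : max (min b (2 * c)) c ≤ max (min a (2 * c)) c := by gcongr
  rw [abs_of_nonneg (by linarith)]
  rcases le_total (min (2 * c) a) (max c b) with h | h
  · rw [ENNReal.ofReal_of_nonpos (by linarith : min (2 * c) a - max c b ≤ 0),
      ENNReal.ofReal_eq_zero]
    grind
  · congr 1
    grind

lemma tsum_enorm_slice_sub_le (a b : ℝ) :
    ∑' j : ℤ, ‖slice (2 ^ j) a - slice (2 ^ j) b‖ₑ ≤ ‖a - b‖ₑ := by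
  wlog hab : b ≤ a generalizing a b
  · have := this b a (le_of_not_ge hab)
    rw [← enorm_neg (a - b), neg_sub]
    refine le_trans (le_of_eq ?_) this
    congr 1; ext j
    rw [← enorm_neg, neg_sub]
  have hmono : Monotone fun j : ℤ => (2 : ℝ) ^ j := zpow_right_mono₀ one_le_two
  have hdisj := hmono.pairwise_disjoint_on_Ioc_succ
  calc _ = ∑' j : ℤ, volume (Set.Ioc ((2 : ℝ) ^ j) (2 ^ Order.succ j) ∩ Set.Ioc b a) := by
        congr 1; ext j
        rw [Real.enorm_eq_ofReal_abs, ofReal_slice_sub (by positivity) hab, Order.succ_eq_add_one,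
          zpow_add_one₀ two_ne_zero, mul_comm]
    _ ≤ volume (⋃ j : ℤ, Set.Ioc ((2 : ℝ) ^ j) (2 ^ Order.succ j) ∩ Set.Ioc b a) :=
        tsum_meas_le_meas_iUnion_of_disjoint _
          (fun j => measurableSet_Ioc.inter measurableSet_Ioc)
          (fun i j hij => (hdisj hij).mono Set.inter_subset_left Set.inter_subset_left)
    _ ≤ volume (Set.Ioc b a) := measure_mono (Set.iUnion_subset fun j => Set.inter_subset_right)
    _ = ‖a - b‖ₑ := by
        rw [Real.volume_Ioc, Real.enorm_eq_ofReal_abs, abs_of_nonneg (by linarith)]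

lemma rpow_one_add {y : ℝ} (hy : 0 ≤ y) (x : ℝ≥0∞) : x ^ (1 + y) = x * x ^ y := by
  rw [ENNReal.rpow_add_of_nonneg _ _ zero_le_one hy, ENNReal.rpow_one]

lemma tsum_rpow_le_rpow_tsum {ι : Type*} {p : ℝ} (hp : 1 ≤ p) (f : ι → ℝ≥0∞) :
    ∑' i, f i ^ p ≤ (∑' i, f i) ^ p := by
  have h : ∀ x : ℝ≥0∞, x ^ p = x * x ^ (p - 1) := fun x => by
    rw [← rpow_one_add (by linarith)]
    simp
  calc ∑' i, f i ^ p ≤ ∑' i, f i * (∑' i, f i) ^ (p - 1) := by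
        refine ENNReal.tsum_le_tsum fun i => ?_
        rw [h]
        exact mul_le_mul_right (ENNReal.rpow_le_rpow (ENNReal.le_tsum i) (by linarith)) _
    _ = _ := by rw [ENNReal.tsum_mul_right, h (∑' i, f i)]

/-- Slice increments sum to at most the increment of |u|, and for p ≥ 1 a sum of p-th powers is at
most the p-th power of the sum; hence no constant is lost. -/
lemma tsum_axesForm_slice_le {n : ℕ} {p : ℝ} (hp : 1 ≤ p) (s : Fin n → ℝ)
    {u : (Fin n → ℝ) → ℝ} (hu : Measurable u) :
    ∑' j : ℤ, axesForm p s (fun x => slice (2 ^ j) |u x|) ≤ axesForm p s u := by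
  have hsm : ∀ j : ℤ, Measurable fun x => slice (2 ^ j) |u x| := fun j =>
    (measurable_slice _).comp (by fun_prop)
  have hincr : ∀ z, ∑' j : ℤ, incr p (fun x => slice (2 ^ j) |u x|) z ≤ incr p u z := by
    intro z
    unfold incr
    rw [← lintegral_tsum]
    · refine lintegral_mono fun x => (tsum_rpow_le_rpow_tsum hp _).trans ?_
      refine ENNReal.rpow_le_rpow ?_ (by linarith)
      refine (tsum_enorm_slice_sub_le _ _).trans ?_
      rw [Real.enorm_eq_ofReal_abs, Real.enorm_eq_ofReal_abs]
      exact ENNReal.ofReal_le_ofReal (abs_abs_sub_abs_le_abs_sub _ _)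
    · intro j
      have := hsm j
      exact (((this.comp (measurable_add_const z)).fun_sub this).enorm.pow_const p).aemeasurable
  unfold axesForm
  rw [Summable.tsum_finsetSum fun k _ => ENNReal.summable]
  refine Finset.sum_le_sum fun k _ => ?_
  rw [ENNReal.tsum_mul_left, ← lintegral_tsum]
  · gcongr with h
    rw [ENNReal.tsum_mul_left]
    gcongr
    exact hincr _
  · intro j
    exact Measurable.aemeasurable
      (Measurable.fun_mul (by fun_prop) (measurable_incr_single (hsm j) p k))

lemma axesForm_const_mul {n : ℕ} {p : ℝ} (hp : 0 ≤ p) (s : Fin n → ℝ)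
    {u : (Fin n → ℝ) → ℝ} (c : ℝ) :
    axesForm p s (fun x => c * u x) = ‖c‖ₑ ^ p * axesForm p s u := by
  have hc : ‖c‖ₑ ^ p ≠ ∞ := by finiteness
  have hincr : ∀ z, incr p (fun x => c * u x) z = ‖c‖ₑ ^ p * incr p u z := by
    intro z
    unfold incr
    rw [← lintegral_const_mul' _ _ hc]
    congr 1; ext x
    rw [← mul_sub, enorm_mul, ENNReal.mul_rpow_of_nonneg _ _ hp]
  unfold axesForm
  rw [Finset.mul_sum]
  refine Finset.sum_congr rfl fun k _ => ?_
  rw [mul_left_comm, ← lintegral_const_mul' _ _ hc]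
  congr 2; ext h
  rw [hincr, mul_left_comm]

/-! ### The recursion over heights and its summation. -/

/-- A sublinear recursion for a sequence that is bounded at `-∞` forces summability. -/
lemma tsum_le_of_recursion {θ : ℝ} (hθ : 0 < θ) (hθ1 : θ < 1) {D E : ℝ≥0∞} {b e : ℤ → ℝ≥0∞}
    (hb : ∀ j, b (j + 1) ≤ D * b j ^ θ * e j) (he : ∑' j, e j ≤ E)
    (hM : ∀ J : ℤ, ∃ M : ℝ≥0∞, M ≠ ∞ ∧ ∀ j ≤ J, b j ≤ M) :
    ∑' j, b j ≤ (D * E) ^ (1 / (1 - θ)) := by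
  set A := (D * E) ^ (1 / (1 - θ)) with hA
  have h1θ : 0 < 1 - θ := by linarith
  have hbA : ∀ J, b J ≤ A := by
    intro J
    obtain ⟨M, hMt, hM⟩ := hM J
    -- The supremum over j ≤ J is finite, so B ≤ D E B^θ may be divided by B^θ. The resulting bound
    -- does not depend on J.
    set B := ⨆ j, ⨆ _ : j ≤ J, b j with hB
    have hBt : B ≠ ∞ := ne_top_of_le_ne_top hMt (iSup₂_le hM)
    have hle : ∀ j ≤ J, b j ≤ B := fun j hj => le_iSup₂ (f := fun j (_ : j ≤ J) => b j) j hj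
    have hBle : B ≤ D * E * B ^ θ := by
      refine iSup₂_le fun j hj => ?_
      have h1 := hb (j - 1)
      rw [sub_add_cancel] at h1
      calc b j ≤ _ := h1
        _ ≤ D * B ^ θ * E := by
            gcongr
            · exact hle _ (by omega)
            · exact (ENNReal.le_tsum _).trans he
        _ = _ := by ring
    refine (hle J le_rfl).trans ?_
    rcases eq_or_ne B 0 with h0 | h0
    · rw [h0]; exact zero_le
    have h2 : B ^ (1 - θ) ≤ D * E := by
      have h3 : B = B ^ (1 - θ) * B ^ θ := by
        rw [← ENNReal.rpow_add _ _ h0 hBt]; simp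
      have h4 : B ^ (1 - θ) * B ^ θ ≤ D * E * B ^ θ := h3.symm.le.trans hBle
      have h5 : B ^ θ ≠ 0 := by simp [h0, hBt]
      have h6 : B ^ θ ≠ ∞ := by simp [h0, hBt]
      exact (ENNReal.mul_le_mul_iff_left h5 h6).1 h4
    rw [hA, one_div, ENNReal.le_rpow_inv_iff h1θ]
    exact h2
  have hshift : ∑' j, b j = ∑' j, b (j + 1) := ((Equiv.addRight (1 : ℤ)).tsum_eq b).symm
  calc ∑' j, b j = _ := hshift
    _ ≤ ∑' j, D * A ^ θ * e j := by
        refine ENNReal.tsum_le_tsum fun j => (hb j).trans ?_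
        gcongr
        exact hbA j
    _ ≤ D * A ^ θ * E := by rw [ENNReal.tsum_mul_left]; gcongr
    _ = (D * E) * (D * E) ^ (1 / (1 - θ) * θ) := by rw [hA, ← ENNReal.rpow_mul]; ring
    _ = A := by
        rw [← rpow_one_add (by positivity)]
        congr 1
        field_simp
        ring

lemma lintegral_rpow_enorm_le_tsum {α : Type*} [MeasurableSpace α] {μ : Measure α} {u : α → ℝ}
    (hu : Measurable u) {q : ℝ} (hq : 0 < q) :
    ∫⁻ x, ‖u x‖ₑ ^ q ∂μ ≤
      2 ^ q * ∑' j : ℤ, ENNReal.ofReal (2 ^ j) ^ q * μ {x | 2 ^ j < |u x|} := by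
  have hS : ∀ j : ℤ, MeasurableSet {x | (2 : ℝ) ^ j < |u x|} := fun j =>
    measurableSet_lt measurable_const (by fun_prop)
  calc _ ≤ ∫⁻ x, 2 ^ q * ∑' j : ℤ, {x | (2 : ℝ) ^ j < |u x|}.indicator
        (fun _ => ENNReal.ofReal (2 ^ j) ^ q) x ∂μ := by
        refine lintegral_mono fun x => ?_
        rcases eq_or_ne (u x) 0 with h0 | h0
        · simp [h0, hq]
        obtain ⟨j, hj1, hj2⟩ := exists_mem_Ioc_zpow (abs_pos.2 h0) one_lt_two
        refine le_trans ?_ (mul_le_mul_right (ENNReal.le_tsum j) _)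
        rw [Set.indicator_of_mem (show x ∈ {x | (2 : ℝ) ^ j < |u x|} from hj1),
          ← ENNReal.mul_rpow_of_nonneg _ _ hq.le, Real.enorm_eq_ofReal_abs]
        refine ENNReal.rpow_le_rpow ?_ hq.le
        rw [show (2 : ℝ≥0∞) = ENNReal.ofReal 2 by simp, ← ENNReal.ofReal_mul two_pos.le]
        refine ENNReal.ofReal_le_ofReal (hj2.trans ?_)
        rw [zpow_add_one₀ two_ne_zero, mul_comm]
    _ = _ := by
        rw [lintegral_const_mul _
            (Measurable.tsum fun j => measurable_const.indicator (hS j)),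
          lintegral_tsum fun j => (measurable_const.indicator (hS j)).aemeasurable]
        congr 2; ext j
        rw [lintegral_indicator_const (hS j)]

/-- The Sobolev inequality in terms of increments along the axes. -/
lemma lintegral_rpow_le_axesForm {n : ℕ} (hn : n ≠ 0) {p s₀ θ q : ℝ} (hp : 1 < p) (hs₀ : 0 < s₀)
    {s : Fin n → ℝ} (hs : ∀ k, s₀ ≤ s k ∧ s k < 1) (hθ : θ = p * sBar s / n) (hθ0 : 0 < θ)
    (hθ1 : θ < 1) (hq : q = p / (1 - θ)) {u : (Fin n → ℝ) → ℝ} (hu : Measurable u)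
    (huL : ∫⁻ x, ‖u x‖ₑ ^ p ≠ ∞) :
    ∫⁻ x, ‖u x‖ₑ ^ q ≤ 2 ^ q *
      (2 ^ q * ENNReal.ofReal (levelConst n p s₀) * axesForm p s u) ^ (1 / (1 - θ)) := by
  have hp0 : 0 < p := by linarith
  have h1θ : 0 < 1 - θ := by linarith
  have hq0 : 0 < q := by rw [hq]; positivity
  -- This homogeneity relation makes the powers of 2^j cancel in the recursion.
  have hqp : q = p + θ * q := by rw [hq]; field_simp; ring
  set c : ℤ → ℝ≥0∞ := fun j => ENNReal.ofReal (2 ^ j) with hc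
  have hc0 : ∀ j, c j ≠ 0 := fun j => by
    simp only [hc, ne_eq, ENNReal.ofReal_eq_zero, not_le]; positivity
  have hct : ∀ j, c j ≠ ∞ := fun j => by simp [hc]
  have hc1 : ∀ j, c (j + 1) = 2 * c j := fun j => by
    simp only [hc]
    rw [zpow_add_one₀ two_ne_zero, mul_comm, ENNReal.ofReal_mul two_pos.le, ENNReal.ofReal_ofNat]
  set a : ℤ → ℝ≥0∞ := fun j => volume {x | (2 : ℝ) ^ j < |u x|} with ha
  have hcheb : ∀ j, c j ^ p * a j ≤ ∫⁻ x, ‖u x‖ₑ ^ p := by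
    intro j
    refine le_trans ?_ (mul_meas_ge_le_lintegral (by fun_prop) (c j ^ p))
    gcongr
    refine measure_mono fun x hx => ENNReal.rpow_le_rpow ?_ hp0.le
    rw [Real.enorm_eq_ofReal_abs]
    exact ENNReal.ofReal_le_ofReal (le_of_lt hx)
  have hat : ∀ j, a j ≠ ∞ := by
    intro j h
    have h1 := hcheb j
    rw [h, ENNReal.mul_top (by simp [hc0, hct])] at h1
    exact huL (top_le_iff.1 h1)
  refine (lintegral_rpow_enorm_le_tsum hu hq0).trans ?_
  gcongr
  refine tsum_le_of_recursion hθ0 hθ1 (e := fun j => axesForm p s (fun x => slice (2 ^ j) |u x|))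
    ?_ (tsum_axesForm_slice_le hp.le s hu) ?_
  · intro j
    have h2j : (0 : ℝ) < 2 ^ j := by positivity
    -- Normalised so that |u| > 2^(j+1) forces v ≥ 1, while the support is exactly {|u| > 2^j}.
    set v : (Fin n → ℝ) → ℝ := fun x => (2 ^ j)⁻¹ * slice (2 ^ j) |u x| with hv
    have hvm : Measurable v := ((measurable_slice _).comp (by fun_prop)).const_mul _
    have hsupp : Function.support v = {x | (2 : ℝ) ^ j < |u x|} := by
      ext x
      simp only [hv, Function.mem_support, Set.mem_ofPred_eq, mul_ne_zero_iff,
        slice_ne_zero_iff h2j]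
      simp [h2j.ne']
    have hsub : a (j + 1) ≤ volume {x | 1 ≤ v x} := by
      refine measure_mono fun x hx => ?_
      have hx' : (2 : ℝ) ^ (j + 1) < |u x| := hx
      rw [zpow_add_one₀ two_ne_zero, mul_comm] at hx'
      have := le_slice h2j hx'.le
      simp only [hv, Set.mem_ofPred_eq]
      rwa [inv_mul_eq_div, one_le_div h2j]
    have hlev := volume_superlevel_le hn hp hs₀ hs (hθ ▸ hθ1.le) hvm (by rw [hsupp]; exact hat j)
    rw [hsupp, ← hθ, hv, axesForm_const_mul hp0.le] at hlev
    have hinv : ‖((2 : ℝ) ^ j)⁻¹‖ₑ ^ p = (c j ^ p)⁻¹ := by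
      rw [Real.enorm_eq_ofReal_abs, abs_of_pos (by positivity), ENNReal.ofReal_inv_of_pos h2j,
        ENNReal.inv_rpow]
    rw [hinv] at hlev
    have hcp0 : c j ^ p ≠ 0 := by simp [hc0, hct]
    have hcpt : c j ^ p ≠ ∞ := by simp [hc0, hct]
    have hcq : c j ^ q = c j ^ p * (c j ^ q) ^ θ := by
      rw [← ENNReal.rpow_mul, ← ENNReal.rpow_add _ _ (hc0 j) (hct j), mul_comm q θ, ← hqp]
    calc c (j + 1) ^ q * a (j + 1) ≤ (2 * c j) ^ q * (ENNReal.ofReal (levelConst n p s₀) *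
          a j ^ θ * ((c j ^ p)⁻¹ * axesForm p s (fun x => slice (2 ^ j) |u x|))) := by
          rw [hc1]
          gcongr
          exact hsub.trans hlev
      _ = 2 ^ q * ENNReal.ofReal (levelConst n p s₀) * ((c j ^ q) ^ θ * a j ^ θ) *
          (c j ^ p * (c j ^ p)⁻¹) * axesForm p s (fun x => slice (2 ^ j) |u x|) := by
          rw [ENNReal.mul_rpow_of_nonneg _ _ hq0.le]
          nth_rewrite 1 [hcq]
          ring
      _ = _ := by
          rw [ENNReal.mul_inv_cancel hcp0 hcpt, mul_one, ENNReal.mul_rpow_of_nonneg _ _ hθ0.le]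
  · intro J
    -- Since b_j = c_j^(θq) (c_j^p a_j), Chebyshev bounds the second factor for all j and the first
    -- increases with j.
    refine ⟨c J ^ (θ * q) * ∫⁻ x, ‖u x‖ₑ ^ p, ENNReal.mul_ne_top (by simp [hc0, hct]) huL, ?_⟩
    intro j hj
    calc c j ^ q * a j = c j ^ (θ * q) * (c j ^ p * a j) := by
          rw [← mul_assoc, ← ENNReal.rpow_add _ _ (hc0 j) (hct j), add_comm, ← hqp]
      _ ≤ _ := by
          gcongr
          · exact ENNReal.ofReal_le_ofReal (zpow_le_zpow_right₀ one_le_two hj)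
          · exact hcheb j

/-! ### From increments along the axes back to the measure `muAxes`. -/

lemma lintegral_muAxes {n : ℕ} (p : ℝ) (s x : Fin n → ℝ) {f : (Fin n → ℝ) → ℝ≥0∞}
    (hf : Measurable f) :
    ∫⁻ y, f y ∂(muAxes p s x) = ∑ k, ENNReal.ofReal (s k * (1 - s k)) *
      ∫⁻ h : ℝ, ENNReal.ofReal (|h| ^ (-1 - s k * p)) * f (x + Pi.single k h) := by
  rw [muAxes, lintegral_finsetSum_measure]
  refine Finset.sum_congr rfl fun k _ => ?_
  rw [lintegral_smul_measure, smul_eq_mul, lintegral_map hf (measurable_update x),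
    lintegral_withDensity_eq_lintegral_mul _ (by fun_prop)
      (show Measurable fun t => f (Function.update x k t) from hf.comp (measurable_update x)),
    ← lintegral_add_left_eq_self _ (x k)]
  congr 2; ext h
  have h1 : Function.update x k (x k + h) = x + Pi.single k h := by
    ext i
    rcases eq_or_ne i k with rfl | hi
    · simp
    · simp [hi]
  simp [h1]

lemma measurable_comp_add_single {n : ℕ} {F : (Fin n → ℝ) × (Fin n → ℝ) → ℝ≥0∞}
    (hF : Measurable F) (k : Fin n) :
    Measurable fun q : (Fin n → ℝ) × ℝ => F (q.1, q.1 + Pi.single k q.2) :=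
  hF.comp (measurable_fst.prodMk
    (measurable_fst.add ((continuous_single k).measurable.comp measurable_snd)))

lemma measurable_lintegral_muAxes {n : ℕ} (p : ℝ) (s : Fin n → ℝ)
    {F : (Fin n → ℝ) × (Fin n → ℝ) → ℝ≥0∞} (hF : Measurable F) :
    Measurable fun x => ∫⁻ y, F (x, y) ∂(muAxes p s x) := by
  have h : ∀ x, ∫⁻ y, F (x, y) ∂(muAxes p s x) = _ := fun x =>
    lintegral_muAxes p s x (hF.comp measurable_prodMk_left)
  simp only [h]
  refine Finset.measurable_fun_sum _ fun k _ => Measurable.const_mul ?_ _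
  exact Measurable.lintegral_prod_right' (ν := (volume : Measure ℝ))
    (f := fun q : (Fin n → ℝ) × ℝ => ENNReal.ofReal (|q.2| ^ (-1 - s k * p)) *
      F (q.1, q.1 + Pi.single k q.2))
    (Measurable.fun_mul (by fun_prop) (measurable_comp_add_single hF k))

lemma lintegral_lintegral_muAxes {n : ℕ} (p : ℝ) (s : Fin n → ℝ)
    {F : (Fin n → ℝ) × (Fin n → ℝ) → ℝ≥0∞} (hF : Measurable F) :
    ∫⁻ x, ∫⁻ y, F (x, y) ∂(muAxes p s x) = ∑ k, ENNReal.ofReal (s k * (1 - s k)) *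
      ∫⁻ h : ℝ, ENNReal.ofReal (|h| ^ (-1 - s k * p)) * ∫⁻ x, F (x, x + Pi.single k h) := by
  have h : ∀ x, ∫⁻ y, F (x, y) ∂(muAxes p s x) = _ := fun x =>
    lintegral_muAxes p s x (hF.comp measurable_prodMk_left)
  have hm : ∀ k, Measurable fun q : (Fin n → ℝ) × ℝ =>
      ENNReal.ofReal (|q.2| ^ (-1 - s k * p)) * F (q.1, q.1 + Pi.single k q.2) := fun k =>
    Measurable.fun_mul (by fun_prop) (measurable_comp_add_single hF k)
  simp only [h]
  rw [lintegral_finsetSum _ fun k _ => ((hm k).lintegral_prod_right').const_mul _]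
  refine Finset.sum_congr rfl fun k _ => ?_
  rw [lintegral_const_mul _ (hm k).lintegral_prod_right',
    lintegral_lintegral_swap (hm k).aemeasurable]
  congr 2; ext h
  simp only
  rw [lintegral_const_mul' _ _ (by simp)]

/-- Modifying a function on a Lebesgue null set does not affect it on almost every axes measure. -/
lemma ae_ae_muAxes {n : ℕ} (p : ℝ) (s : Fin n → ℝ) {u v : (Fin n → ℝ) → ℝ}
    (huv : u =ᵐ[volume] v) : ∀ᵐ x, u =ᵐ[muAxes p s x] v := by
  set N := toMeasurable volume {x | ¬ u x = v x} with hN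
  have hNm : MeasurableSet N := measurableSet_toMeasurable _ _
  have hN0 : volume N = 0 := by rw [hN, measure_toMeasurable]; exact huv
  have hF : Measurable fun q : (Fin n → ℝ) × (Fin n → ℝ) =>
      N.indicator (fun _ => (1 : ℝ≥0∞)) q.2 :=
    (measurable_const.indicator hNm).comp measurable_snd
  -- The measures `muAxes p s x` are singular, but by Tonelli it suffices that for each fixed
  -- displacement the translate of N is null.
  have h0 : ∫⁻ x, ∫⁻ y, N.indicator (fun _ => (1 : ℝ≥0∞)) y ∂(muAxes p s x) = 0 := by
    rw [lintegral_lintegral_muAxes p s hF]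
    refine Finset.sum_eq_zero fun k _ => ?_
    have : ∀ h : ℝ, ∫⁻ x : Fin n → ℝ, N.indicator (fun _ => (1 : ℝ≥0∞)) (x + Pi.single k h) = 0 := by
      intro h
      rw [lintegral_add_right_eq_self (N.indicator fun _ => (1 : ℝ≥0∞)),
        lintegral_indicator_const hNm, hN0, mul_zero]
    simp [this]
  rw [lintegral_eq_zero_iff (measurable_lintegral_muAxes p s hF)] at h0
  filter_upwards [h0] with x hx
  rw [lintegral_indicator_const hNm, one_mul] at hx
  exact measure_mono_null (subset_toMeasurable _ _) hx

lemma axesForm_eq_lintegral {n : ℕ} {p : ℝ} (hp : 0 ≤ p) (s : Fin n → ℝ)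
    {u v : (Fin n → ℝ) → ℝ} (hv : Measurable v) (huv : u =ᵐ[volume] v) :
    axesForm p s v = ∫⁻ x, ∫⁻ y, ENNReal.ofReal (|u x - u y| ^ p) ∂(muAxes p s x) := by
  have h1 : ∫⁻ x, ∫⁻ y, ENNReal.ofReal (|u x - u y| ^ p) ∂(muAxes p s x) =
      ∫⁻ x, ∫⁻ y, ‖v y - v x‖ₑ ^ p ∂(muAxes p s x) := by
    refine lintegral_congr_ae ?_
    filter_upwards [huv, ae_ae_muAxes p s huv] with x hx hxy
    refine lintegral_congr_ae ?_
    filter_upwards [hxy] with y hy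
    rw [hx, hy, abs_sub_comm, Real.enorm_eq_ofReal_abs,
      ENNReal.ofReal_rpow_of_nonneg (abs_nonneg _) hp]
  rw [h1, lintegral_lintegral_muAxes p s (F := fun q => ‖v q.2 - v q.1‖ₑ ^ p) (by fun_prop)]
  rfl

/-- The `L^q` norm is controlled by the energy, with an explicit constant. -/
lemma eLpNorm_rpow_le {n : ℕ} (hn : n ≠ 0) {p s₀ θ q : ℝ} (hp : 1 < p) (hs₀ : 0 < s₀)
    {s : Fin n → ℝ} (hs : ∀ k, s₀ ≤ s k ∧ s k < 1) (hθ : θ = p * sBar s / n) (hθ0 : 0 < θ)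
    (hθ1 : θ < 1) (hq : q = p / (1 - θ)) {u : (Fin n → ℝ) → ℝ} (hu : Measurable u)
    (huL : MemLp u (ENNReal.ofReal p) volume) :
    eLpNorm u (ENNReal.ofReal q) volume ^ p ≤
      ENNReal.ofReal (2 ^ p * 2 ^ q * levelConst n p s₀) * axesForm p s u := by
  have hp0 : 0 < p := by linarith
  have h1θ : 0 < 1 - θ := by linarith
  have hq0 : 0 < q := by rw [hq]; positivity
  have huL' : ∫⁻ x, ‖u x‖ₑ ^ p ≠ ∞ := by
    have := lintegral_rpow_enorm_lt_top_of_eLpNorm_lt_top (by simpa using hp0) (by simp) huL.2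
    rw [ENNReal.toReal_ofReal hp0.le] at this
    exact this.ne
  have h := lintegral_rpow_le_axesForm hn hp hs₀ hs hθ hθ0 hθ1 hq hu huL'
  rw [eLpNorm_eq_lintegral_rpow_enorm_toReal (by simpa using hq0) (by simp),
    ENNReal.toReal_ofReal hq0.le, ← ENNReal.rpow_mul]
  refine (ENNReal.rpow_le_rpow h (by positivity)).trans (le_of_eq ?_)
  have e1 : q * (1 / q * p) = p := by field_simp
  -- Because q (1 - θ) = p, the p-th power of the norm is linear in the energy.
  have e2 : 1 / (1 - θ) * (1 / q * p) = 1 := by rw [hq]; field_simp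
  rw [ENNReal.mul_rpow_of_nonneg _ _ (by positivity), ← ENNReal.rpow_mul, ← ENNReal.rpow_mul,
    e1, e2, ENNReal.rpow_one, ENNReal.ofReal_mul (by positivity),
    ENNReal.ofReal_mul (by positivity), ← ENNReal.ofReal_rpow_of_pos two_pos,
    ← ENNReal.ofReal_rpow_of_pos two_pos, ENNReal.ofReal_ofNat]
  ring

end AxesSobolev

theorem theorem2p4 (n : ℕ) (p pstar s₀ : ℝ) (hp : 1 < p) (hs₀ : 0 < s₀) (hs₀' : s₀ < 1) :
    ∃ C : ℝ, 0 < C ∧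
      ∀ s : Fin n → ℝ, (∀ k, s₀ ≤ s k ∧ s k < 1) →
        p < (n : ℝ) / AxesSobolev.sBar s →
        pstar = AxesSobolev.sobolevExponent p s →
        ∀ u ∈ AxesSobolev.vSpace p (AxesSobolev.muAxes p s) Set.univ,
          eLpNorm u (ENNReal.ofReal pstar) volume ^ p ≤
            ENNReal.ofReal C *
              ∫⁻ x, ∫⁻ y, ENNReal.ofReal (|u x - u y| ^ p) ∂(AxesSobolev.muAxes p s x) := by
  -- The exponent q enters as `pstar`, so the constant is fixed before the orders are chosen.
  refine ⟨2 ^ p * 2 ^ pstar * AxesSobolev.levelConst n p s₀,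
    mul_pos (by positivity) (AxesSobolev.levelConst_pos hp hs₀), ?_⟩
  rintro s hs hps hpstar u ⟨hu, huL, -⟩
  have hp0 : 0 < p := by linarith
  have hn : n ≠ 0 := by
    rintro rfl
    simp at hps
    linarith
  have hn' : (0 : ℝ) < n := by positivity
  have hsB := AxesSobolev.sBar_pos hn s fun k => hs₀.trans_le (hs k).1
  rw [lt_div_iff₀ hsB] at hps
  rw [Measure.restrict_univ] at huL
  have hq : pstar = p / (1 - p * AxesSobolev.sBar s / n) := by
    rw [hpstar, AxesSobolev.sobolevExponent]
    have h1 : (n : ℝ) - p * AxesSobolev.sBar s ≠ 0 := by linarith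
    have h2 : 1 - p * AxesSobolev.sBar s / n = (n - p * AxesSobolev.sBar s) / n := by
      field_simp
    rw [h2, div_div_eq_mul_div, mul_comm]
  -- Both sides are unchanged on passing to a Borel representative of u.
  rw [eLpNorm_congr_ae hu.ae_eq_mk,
    ← AxesSobolev.axesForm_eq_lintegral hp0.le s hu.measurable_mk hu.ae_eq_mk]
  exact AxesSobolev.eLpNorm_rpow_le hn hp hs₀ hs rfl (by positivity)
    ((div_lt_one hn').2 hps) hq hu.measurable_mk (huL.ae_eq hu.ae_eq_mk)
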